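/- Let $N\ge 1$, and let $c,\omega,\tau,\beta,\gamma,\alpha_1,\dots,\alpha_N$ be real numbers. Put $\sigma=\omega-c^2/4$, $c_\tau=c-\tau$, and assume $$c>0,\quad \sigma>0,\quad \tau\le c,\quad \beta\ge 0,\quad \gamma>0,\quad \alpha_j>0\ (1\le j\le N).$$ Let $\mathcal Y=H^1(\mathbb R)^{N+1}$ (real-valued functions), and for $\Theta=(f_1,\dots,f_N,g)\in\mathcal Y$ put $$\mathsf K(\Theta)=\int_{-\infty}^{\infty}\Big(\sum_{j=1}^N\big((f_j')^2+\sigma f_j^2\big)+\gamma (g')^2+c_\tau g^2\Big)dx,\qquad F(\Theta)=\tfrac13\beta g^3+\big(\alpha_1f_1^2+\dots+\alpha_Nf_N^2\big)g.$$ For $\lambda>0$ let (P1) be the problem of minimizing $\mathsf K(\Theta)$ over all $\Theta\in\mathcal Y$ with $\int_{-\infty}^{\infty} F(\Theta)\,dx=\lambda$, and let $I_\lambda$ be the infimum in (P1). Let (P2) be the problem of minimizing $$\Lambda(\Theta)=\frac{\mathsf K(\Theta)}{\left(\int_{-\infty}^{\infty} F(\Theta)\,dx\right)^{2/3}}$$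 over all $0\ne\Theta\in\mathcal Y$, where $t^{1/3}$ denotes the real cube root of $t\in\mathbb R$, $t^{2/3}=(t^{1/3})^2$, and $\Lambda(\Theta)=+\infty$ if $\int F(\Theta)\,dx=0$; a minimizer of (P2) is understood to have a finite value of $\Lambda$. **Proposition 3.4 (equivalence of (P1) and (P2)).** (a) For every $\lambda>0$, every solution $U$ of (P1) is a minimizer of (P2). (b) If $\Delta$ is a minimizer of (P2), then for every $\lambda>0$ the rescaled tuple $$U_\lambda=\frac{\lambda^{1/3}}{\left(\int_{-\infty}^{\infty}F(\Delta)\,dx\right)^{1/3}}\,\Delta$$ is a solution of (P1). (c) If $\Delta$ is a minimizer of (P2), define $$\Theta=\frac23\,\Lambda(\Delta)\,\frac{\Delta}{\left(\int_{-\infty}^{\infty}F(\Delta)\,dx\right)^{1/3}} .$$ Then $\Theta=\frac23 I_1\,\lambda^{-1/3}\,U_\lambda$ for every $\lambda>0$; in particular the right-hand side does not depend on $\lambda$. Likewise, if $U$ is a solution of (P1) for some $\lambda>0$, then the tuple $\Theta$ defined from $\Delta=U$ equals $\frac23 I_1\lambda^{-1/3}U$. (d) For $\Theta$ as in (c), after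 modification on a null set, $\Theta=(\Phi_1,\dots,\Phi_N,\Psi)$ has $C^\infty$ components and solves $$\Phi_j''-\sigma\Phi_j=-\alpha_j\Phi_j\Psi\quad(1\le j\le N),\qquad \gamma\Psi''-c_\tau\Psi=-\tfrac12\beta\Psi^2-\tfrac12\big(\alpha_1\Phi_1^2+\dots+\alpha_N\Phi_N^2\big)$$ on $\mathbb R$. Therefore, with $\phi_j(x)=e^{icx/2}\Phi_j(x)$, the functions $$u_j(x,t)=e^{i\omega t}\phi_j(x-ct),\qquad v(x,t)=\Psi(x-ct)$$ form a travelling solitary wave: $\phi_1,\dots,\phi_N,\Psi$ are $H^1$ functions that vanish at $\pm\infty$ and are not all identically zero, and $(u_1,\dots,u_N,v)$ is a classical solution of $$i\partial_tu_j+\partial_x^2u_j=-\alpha_ju_jv\quad(1\le j\le N),\qquad \partial_tv+\partial_x\big(\gamma\partial_x^2v+\tau v+\tfrac{\beta}{2}v^2\big)=-\partial_x\Big(\sum_{j=1}^N\tfrac{\alpha_j}{2}|u_j|^2\Big).$$ -/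

import Mathlib

open MeasureTheory Filter Topology
open scoped ContDiff

noncomputable section

namespace LSI

/-- The real cube root `t ^ (1/3)`, for every real `t` (odd in `t`). -/
def cbrt (t : ℝ) : ℝ := (SignType.sign t : ℝ) * |t| ^ (1 / 3 : ℝ)

theorem cbrt_pow_three (t : ℝ) : cbrt t ^ 3 = t := by
  have h : (|t| ^ (1 / 3 : ℝ)) ^ 3 = |t| := by
    rw [← Real.rpow_natCast, ← Real.rpow_mul (abs_nonneg t)]
    norm_num
  unfold cbrt
  rw [mul_pow, h]
  rcases lt_trichotomy t 0 with ht | ht | ht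
  · simp [sign_neg ht, abs_of_neg ht]
    ring
  · simp [ht]
  · simp [sign_pos ht, abs_of_pos ht]

/-- `g` is a weak (distributional) derivative of `f` on the real line. -/
def HasWeakDeriv {E : Type*} [NormedAddCommGroup E] [NormedSpace ℝ E] (f g : ℝ → E) : Prop :=
  LocallyIntegrable f volume ∧ LocallyIntegrable g volume ∧
    ∀ η : ℝ → ℝ, ContDiff ℝ ∞ η → HasCompactSupport η →
      ∫ x, deriv η x • f x = -∫ x, η x • g x

/-- Membership in the Sobolev space `H¹(ℝ; E)`: `f` is square integrable and has a square
integrable weak derivative. -/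
def MemH1 {E : Type*} [NormedAddCommGroup E] [NormedSpace ℝ E] (f : ℝ → E) : Prop :=
  MemLp f 2 volume ∧ ∃ g : ℝ → E, MemLp g 2 volume ∧ HasWeakDeriv f g

open Classical in
/-- The weak derivative of an `H¹` function (unique up to null sets); `0` outside `H¹`. -/
def weakDeriv (f : ℝ → ℝ) : ℝ → ℝ :=
  if h : ∃ g : ℝ → ℝ, MemLp g 2 volume ∧ HasWeakDeriv f g then h.choose else 0

/-- Real parameters of the system with `N` short waves: the coefficients `α₁, …, α_N, β, γ, τ` of
the equations, and the speed `c` and the frequency `ω` (written `om`) of the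
travelling wave. -/
structure Params (N : ℕ) where
  α : Fin N → ℝ
  β : ℝ
  γ : ℝ
  τ : ℝ
  c : ℝ
  om : ℝ

/-- `(N+1)`-tuples `(f₁, …, f_N, g)` of real functions on the line, with componentwise operations;
`Θ.1 j` is the `j`-th of the first `N` components and `Θ.2` is the last component. -/
abbrev Tuple (N : ℕ) : Type := (Fin N → ℝ → ℝ) × (ℝ → ℝ)

/-- The space `𝒴 = H¹(ℝ) × ⋯ × H¹(ℝ)` (`N + 1` factors). -/
def MemY {N : ℕ} (Θ : Tuple N) : Prop := (∀ j, MemH1 (Θ.1 j)) ∧ MemH1 Θ.2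

/-- Two tuples represent the same element of `𝒴`. -/
def AEEqual {N : ℕ} (Θ Θ' : Tuple N) : Prop :=
  (∀ j, Θ.1 j =ᵐ[volume] Θ'.1 j) ∧ Θ.2 =ᵐ[volume] Θ'.2

namespace Params

variable {N : ℕ} (p : Params N)

/-- `σ = ω - c² / 4`. -/
def σ : ℝ := p.om - p.c ^ 2 / 4

/-- `c_τ = c - τ`. -/
def cτ : ℝ := p.c - p.τ

/-- The quadratic functional
`K(f₁, …, f_N, g) = ∫ (∑ⱼ ((fⱼ')² + σ fⱼ²) + γ (g')² + c_τ g²) dx`,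
which is the quadratic form on `𝒴` of the diagonal operator with entries
`σ - ∂ₓₓ` (`N` times) and `c_τ - γ ∂ₓₓ`. -/
def K (Θ : Tuple N) : ℝ :=
  ∫ x, ((∑ j, (weakDeriv (Θ.1 j) x ^ 2 + p.σ * Θ.1 j x ^ 2)) +
    (p.γ * weakDeriv Θ.2 x ^ 2 + p.cτ * Θ.2 x ^ 2))

/-- The density `F(f₁, …, f_N, g) = (1/3) β g³ + (α₁ f₁² + ⋯ + α_N f_N²) g`. -/
def F (Θ : Tuple N) (x : ℝ) : ℝ :=
  1 / 3 * p.β * Θ.2 x ^ 3 + (∑ j, p.α j * Θ.1 j x ^ 2) * Θ.2 x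

/-- `∫ F(Θ) dx`. -/
def intF (Θ : Tuple N) : ℝ := ∫ x, p.F Θ x

/-- The admissible set `{Θ ∈ 𝒴 : ∫ F(Θ) dx = lam}` of the constrained problem. -/
def admissible (lam : ℝ) : Set (Tuple N) := {Θ | MemY Θ ∧ p.intF Θ = lam}

/-- `I_lam`, the infimum of `K` over the admissible set. -/
def I (lam : ℝ) : ℝ := sInf (p.K '' p.admissible lam)

/-- `Θ` is a solution of the constrained problem: it minimizes `K` over the admissible set. -/
def IsConstrainedMin (lam : ℝ) (Θ : Tuple N) : Prop :=
  Θ ∈ p.admissible lam ∧ ∀ Θ' ∈ p.admissible lam, p.K Θ ≤ p.K Θ'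

/-- The Weinstein quotient `Λ(Θ) = K(Θ) / (∫ F(Θ) dx) ^ (2/3)`, used where `∫ F(Θ) dx ≠ 0`;
here `t ^ (2/3)` is the square of the real cube root of `t`. -/
def Lam (Θ : Tuple N) : ℝ := p.K Θ / cbrt (p.intF Θ) ^ 2

/-- `Θ` minimizes `Λ` over the nonzero elements of `𝒴`. The quotient is defined where
`∫ F ≠ 0`, which excludes `Θ = 0`; a nonzero tuple with `∫ F = 0` counts as having
`Λ = +∞`: it is no minimizer and no constraint as a competitor. -/
def IsQuotientMin (Θ : Tuple N) : Prop :=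
  (MemY Θ ∧ ¬ AEEqual Θ 0 ∧ p.intF Θ ≠ 0) ∧
    ∀ Θ' : Tuple N, MemY Θ' → ¬ AEEqual Θ' 0 → p.intF Θ' ≠ 0 → p.Lam Θ ≤ p.Lam Θ'

/-- The rescaling `Δ ↦ lam ^ (1/3) / (∫ F(Δ) dx) ^ (1/3) · Δ`. -/
def rescale (lam : ℝ) (Δ : Tuple N) : Tuple N := (cbrt lam / cbrt (p.intF Δ)) • Δ

/-- The tuple `(2/3) Λ(Δ) Δ / (∫ F(Δ) dx) ^ (1/3)`. -/
def profile (Δ : Tuple N) : Tuple N := (2 / 3 * p.Lam Δ / cbrt (p.intF Δ)) • Δ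

/-- `(Φ₁, …, Φ_N, Ψ)` is a classical (`C^∞`) solution of the solitary-wave equations
`Φⱼ'' - σ Φⱼ = -αⱼ Φⱼ Ψ`, `γ Ψ'' - c_τ Ψ = -(1/2) β Ψ² - (1/2) (α₁ Φ₁² + ⋯ + α_N Φ_N²)`. -/
def SolvesODE (Φ : Tuple N) : Prop :=
  (∀ j, ContDiff ℝ ∞ (Φ.1 j)) ∧ ContDiff ℝ ∞ Φ.2 ∧
  (∀ j x, deriv (deriv (Φ.1 j)) x - p.σ * Φ.1 j x = -p.α j * Φ.1 j x * Φ.2 x) ∧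
  ∀ x, p.γ * deriv (deriv Φ.2) x - p.cτ * Φ.2 x =
    -(1 / 2) * p.β * Φ.2 x ^ 2 - 1 / 2 * ∑ j, p.α j * Φ.1 j x ^ 2

end Params

/-- `(u₁, …, u_N, v)`, as functions of `(x, t)`, is a classical solution of the long-wave--short-wave
system
`i ∂ₜ uⱼ + ∂ₓ² uⱼ = -αⱼ uⱼ v`,
`∂ₜ v + ∂ₓ (γ ∂ₓ² v + Q(v)) = -∂ₓ (b₁ |u₁|² + ⋯ + b_N |u_N|²)`. -/
def SolvesLSI {N : ℕ} (α b : Fin N → ℝ) (γ : ℝ) (Q : ℝ → ℝ)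
    (u : Fin N → ℝ → ℝ → ℂ) (v : ℝ → ℝ → ℝ) : Prop :=
  (∀ j, ContDiff ℝ 2 (fun z : ℝ × ℝ => u j z.1 z.2)) ∧
  ContDiff ℝ 3 (fun z : ℝ × ℝ => v z.1 z.2) ∧
  (∀ j x t, Complex.I * deriv (fun s => u j x s) t + deriv (deriv (fun y => u j y t)) x =
    -(α j : ℂ) * u j x t * (v x t : ℂ)) ∧
  ∀ x t, deriv (fun s => v x s) t +
      deriv (fun y => γ * deriv (deriv (fun z => v z t)) y + Q (v y t)) x =
    -deriv (fun y => ∑ j, b j * ‖u j y t‖ ^ 2) x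

/-- The profiles `φ₁, …, φ_N, Ψ` give a solitary wave: they are in `H¹`, vanish at `±∞`, are not
all identically zero, and
`uⱼ(x, t) = e^{iωt} φⱼ(x - ct)`, `v(x, t) = Ψ(x - ct)`
solves the long-wave--short-wave system with `bⱼ = αⱼ / 2` and `Q(v) = τ v + (β / 2) v²`. -/
def Params.IsSolitaryWave {N : ℕ} (p : Params N) (φ : Fin N → ℝ → ℂ) (Ψ : ℝ → ℝ) : Prop :=
  (∀ j, MemH1 (φ j)) ∧ MemH1 Ψ ∧
  (∀ j, Tendsto (φ j) (cocompact ℝ) (𝓝 0)) ∧ Tendsto Ψ (cocompact ℝ) (𝓝 0) ∧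
  ((∃ j, φ j ≠ 0) ∨ Ψ ≠ 0) ∧
  SolvesLSI p.α (fun j => p.α j / 2) p.γ (fun v => p.τ * v + p.β / 2 * v ^ 2)
    (fun j x t => Complex.exp (Complex.I * p.om * t) * φ j (x - p.c * t))
    (fun x t => Ψ (x - p.c * t))

end LSI

end

/-! `K` is homogeneous of degree 2 and `intF` of degree 3, so `Lam` is invariant under scaling. The
real cube root is odd, so every tuple with `intF ≠ 0`, of either sign, rescales to `intF = lam`,
where `K` equals `cbrt lam ^ 2` times `Lam`. Hence the two problems have the same minimizers up to
scaling, and `I 1` is the minimum of `Lam` (`K_rescale`, `IsConstrainedMin.isQuotientMin`,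
`IsQuotientMin.isConstrainedMin_rescale`).

For the differential equations, minimality is used as the polynomial inequality `Lam Δ ^ 3 * intF ^
2 ≤ K ^ 3` on all of 𝒴, with equality at `profile Δ`. Along a line through the profile both sides
are polynomials in `t`, so their derivatives at 0 agree (`stationary_of_nonneg`). The factor 2/3 in
`profile` turns this into `dK = d(intF)`, with no multiplier left (`hasWeakDeriv_flux`).

The resulting weak equations become classical because in one dimension a function is almost
everywhere a primitive of its weak derivative (`HasWeakDeriv.exists_eq_primitive`). Smoothness
follows by bootstrapping, decay from the integrability of `(f²)' = 2ff'`, and non-triviality from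
`Lam Δ > 0`. -/

namespace LSI

/-! ### Calculus of weak derivatives. -/

section WeakDerivative

variable {E : Type*} [NormedAddCommGroup E] [NormedSpace ℝ E]

theorem integrable_test_smul {f : ℝ → E} (hf : LocallyIntegrable f volume) {η : ℝ → ℝ}
    (hη : Continuous η) (hc : HasCompactSupport η) : Integrable (fun x => η x • f x) :=
  hf.integrable_smul_left_of_hasCompactSupport hη hc

theorem integrable_deriv_test_smul {f : ℝ → E} (hf : LocallyIntegrable f volume) {η : ℝ → ℝ}
    (hη : ContDiff ℝ ∞ η) (hc : HasCompactSupport η) :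
    Integrable (fun x => deriv η x • f x) :=
  hf.integrable_smul_left_of_hasCompactSupport (hη.continuous_deriv (by simp)) hc.deriv

theorem HasWeakDeriv.congr {f f' g g' : ℝ → E} (h : HasWeakDeriv f g) (hf : f =ᵐ[volume] f')
    (hg : g =ᵐ[volume] g') : HasWeakDeriv f' g' := by
  refine ⟨h.1.congr hf, h.2.1.congr hg, fun η hη hc => ?_⟩
  have e1 : ∫ x, deriv η x • f' x = ∫ x, deriv η x • f x :=
    integral_congr_ae (hf.mono fun x hx => congrArg (deriv η x • ·) hx.symm)
  have e2 : ∫ x, η x • g' x = ∫ x, η x • g x :=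
    integral_congr_ae (hg.mono fun x hx => congrArg (η x • ·) hx.symm)
  rw [e1, e2, h.2.2 η hη hc]

theorem HasWeakDeriv.add {f f' g g' : ℝ → E} (h : HasWeakDeriv f g) (h' : HasWeakDeriv f' g') :
    HasWeakDeriv (f + f') (g + g') := by
  refine ⟨h.1.add h'.1, h.2.1.add h'.2.1, fun η hη hc => ?_⟩
  simp only [Pi.add_apply, smul_add]
  rw [integral_add (integrable_deriv_test_smul h.1 hη hc)
      (integrable_deriv_test_smul h'.1 hη hc),
    integral_add (integrable_test_smul h.2.1 hη.continuous hc)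
      (integrable_test_smul h'.2.1 hη.continuous hc), h.2.2 η hη hc, h'.2.2 η hη hc, neg_add]

theorem HasWeakDeriv.const_smul {f g : ℝ → E} (h : HasWeakDeriv f g) (c : ℝ) :
    HasWeakDeriv (c • f) (c • g) := by
  refine ⟨h.1.smul c, h.2.1.smul c, fun η hη hc => ?_⟩
  simp only [Pi.smul_apply, smul_comm _ c]
  rw [integral_smul, integral_smul, h.2.2 η hη hc, smul_neg]

theorem HasWeakDeriv.unique [CompleteSpace E] {f g g' : ℝ → E} (h : HasWeakDeriv f g)
    (h' : HasWeakDeriv f g') : g =ᵐ[volume] g' := by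
  refine ae_eq_of_integral_contDiff_smul_eq h.2.1 h'.2.1 fun η hη hc => ?_
  rw [← neg_inj, ← h.2.2 η hη hc, h'.2.2 η hη hc]

theorem hasWeakDeriv_of_hasDerivAt {f f' : ℝ → E} (h : ∀ x, HasDerivAt f (f' x) x)
    (hf' : Continuous f') : HasWeakDeriv f f' := by
  have hf : Continuous f := continuous_iff_continuousAt.2 fun x => (h x).continuousAt
  refine ⟨hf.locallyIntegrable, hf'.locallyIntegrable, fun η hη hc => ?_⟩
  have key := integral_bilinear_hasDerivAt_right_eq_neg_left_of_integrable
    (L := ContinuousLinearMap.lsmul ℝ ℝ) (u := η) (u' := deriv η) (v := f) (v' := f')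
    (fun x _ => (hη.differentiable (by simp) x).hasDerivAt) (fun x _ => h x)
    (integrable_test_smul hf'.locallyIntegrable hη.continuous hc)
    (integrable_deriv_test_smul hf.locallyIntegrable hη hc)
    (integrable_test_smul hf.locallyIntegrable hη.continuous hc)
  simp only [ContinuousLinearMap.lsmul_apply] at key
  rw [key, neg_neg]

theorem memH1_of_hasDerivAt {f f' : ℝ → E} (h : ∀ x, HasDerivAt f (f' x) x)
    (hc : Continuous f') (hf : MemLp f 2 volume) (hf' : MemLp f' 2 volume) : MemH1 f :=
  ⟨hf, f', hf', hasWeakDeriv_of_hasDerivAt h hc⟩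

end WeakDerivative

/-! ### Primitives and continuous representatives on the line. -/

theorem exists_tsupport_subset_Ioo {η : ℝ → ℝ} (hc : HasCompactSupport η) :
    ∃ R : ℝ, 0 < R ∧ tsupport η ⊆ Set.Ioo (-R) R := by
  obtain ⟨R, hR, h⟩ := hc.isCompact.isBounded.subset_ball_lt 0 0
  exact ⟨R, hR, by simpa [Real.ball_eq_Ioo] using h⟩

theorem integral_eq_intervalIntegral_of_support {h : ℝ → ℝ} {R : ℝ}
    (hs : Function.support h ⊆ Set.Ioo (-R) R) : ∫ x, h x = ∫ x in (-R)..R, h x :=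
  (intervalIntegral.integral_eq_integral_of_support_subset
    (hs.trans Set.Ioo_subset_Ioc_self)).symm

theorem locallyIntegrable_intervalIntegrable {g : ℝ → ℝ} (hg : LocallyIntegrable g volume)
    (a b : ℝ) : IntervalIntegrable g volume a b :=
  (hg.integrableOn_isCompact isCompact_uIcc).intervalIntegrable

theorem continuous_primitive_of_locallyIntegrable {g : ℝ → ℝ}
    (hg : LocallyIntegrable g volume) : Continuous fun x => ∫ t in (0 : ℝ)..x, g t :=
  intervalIntegral.continuous_primitive (locallyIntegrable_intervalIntegrable hg) 0

/-- The primitive is absolutely continuous with derivative `g` almost everywhere (Lebesgue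
differentiation), so it can be integrated by parts against a test function. -/
theorem hasWeakDeriv_primitive {g : ℝ → ℝ} (hg : LocallyIntegrable g volume) :
    HasWeakDeriv (fun x => ∫ t in (0 : ℝ)..x, g t) g := by
  refine ⟨(continuous_primitive_of_locallyIntegrable hg).locallyIntegrable, hg,
    fun η hη hc => ?_⟩
  set G : ℝ → ℝ := fun x => ∫ t in (0 : ℝ)..x, g t
  obtain ⟨R, hR, hs⟩ := exists_tsupport_subset_Ioo hc
  have hη' : Function.support η ⊆ Set.Ioo (-R) R := (subset_tsupport η).trans hs
  have hd : Function.support (deriv η) ⊆ Set.Ioo (-R) R := (support_deriv_subset).trans hs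
  simp only [smul_eq_mul]
  rw [integral_eq_intervalIntegral_of_support
      ((Function.support_mul_subset_left (deriv η) G).trans hd),
    integral_eq_intervalIntegral_of_support ((Function.support_mul_subset_left η g).trans hη')]
  have hGac : AbsolutelyContinuousOnInterval G (-R) R :=
    (locallyIntegrable_intervalIntegrable hg (-R) R).absolutelyContinuousOnInterval_intervalIntegral
      (c := 0) (by rw [Set.uIcc_of_le (by linarith)]; constructor <;> linarith)
  have hηac : AbsolutelyContinuousOnInterval η (-R) R := by
    obtain ⟨K, hK⟩ := (hη.of_le (by simp) : ContDiff ℝ 1 η).lipschitzWith_of_hasCompactSupport hc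
      (by simp)
    exact (hK.lipschitzOnWith).absolutelyContinuousOnInterval
  have hz : ∀ x, x ∉ Set.Ioo (-R) R → η x = 0 := fun x hx =>
    Function.notMem_support.1 fun h => hx (hη' h)
  -- The boundary terms vanish: the support of `η` lies in the open interval, so `η (±R) = 0`.
  have key := hηac.integral_mul_deriv_eq_deriv_mul hGac
  rw [hz R (by simp), hz (-R) (by simp)] at key
  have hae : ∫ x in (-R)..R, η x * deriv G x = ∫ x in (-R)..R, η x * g x := by
    refine intervalIntegral.integral_congr_ae ?_
    filter_upwards [LocallyIntegrable.ae_hasDerivAt_integral hg] with x hx _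
    rw [(hx 0).deriv]
  rw [hae] at key
  linarith

/-- Integrating from the left of the support gives a primitive that vanishes on the left; the zero
mean makes it vanish on the right as well. -/
theorem exists_test_primitive {ψ : ℝ → ℝ} (hψ : ContDiff ℝ ∞ ψ) (hc : HasCompactSupport ψ)
    (h0 : ∫ x, ψ x = 0) :
    ∃ η : ℝ → ℝ, ContDiff ℝ ∞ η ∧ HasCompactSupport η ∧ deriv η = ψ := by
  obtain ⟨R, hR, hs⟩ := exists_tsupport_subset_Ioo hc
  have hs' : Function.support ψ ⊆ Set.Ioo (-R) R := (subset_tsupport ψ).trans hs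
  have hd : ∀ x, HasDerivAt (fun y => ∫ t in (-R)..y, ψ t) (ψ x) x := fun x =>
    intervalIntegral.integral_hasDerivAt_right (hψ.continuous.intervalIntegrable _ _)
      (hψ.continuous.stronglyMeasurableAtFilter _ _) hψ.continuous.continuousAt
  have hderiv : deriv (fun y => ∫ t in (-R)..y, ψ t) = ψ := funext fun x => (hd x).deriv
  refine ⟨fun y => ∫ t in (-R)..y, ψ t, ?_, ?_, hderiv⟩
  · rw [contDiff_infty_iff_deriv, hderiv]
    exact ⟨fun x => (hd x).differentiableAt, hψ⟩
  · refine HasCompactSupport.intro (isCompact_Icc (a := -R) (b := R)) fun x hx => ?_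
    have hz : ∀ t, t ∉ Set.Ioo (-R) R → ψ t = 0 := fun t ht =>
      Function.notMem_support.1 fun h => ht (hs' h)
    rcases lt_or_ge x (-R) with hx' | hx'
    · refine intervalIntegral.integral_zero_ae (ae_of_all _ fun t ht => hz t ?_)
      rw [Set.uIoc_of_ge hx'.le] at ht
      exact fun h => absurd h.1 (not_lt.2 ht.2)
    · have hxR : R < x := by
        by_contra h
        exact hx ⟨hx', not_lt.1 h⟩
      rw [intervalIntegral.integral_eq_integral_of_support_subset, h0]
      exact hs'.trans fun t ht => ⟨ht.1, ht.2.le.trans hxR.le⟩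

/-- Du Bois-Reymond's argument: for a bump `ρ` of integral 1, `φ - (∫ φ) ρ` has zero mean and so is
the derivative of a test function. Therefore `∫ φ f = (∫ φ) (∫ ρ f)` for every test function `φ`,
which identifies `f` with the constant `∫ ρ f`. -/
theorem HasWeakDeriv.ae_const {f : ℝ → ℝ} (h : HasWeakDeriv f 0) :
    ∃ C : ℝ, f =ᵐ[volume] fun _ => C := by
  let b : ContDiffBump (0 : ℝ) := ⟨1, 2, one_pos, one_lt_two⟩
  set ρ : ℝ → ℝ := b.normed volume
  have hρ : ContDiff ℝ ∞ ρ := b.contDiff_normed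
  have hρc : HasCompactSupport ρ := b.hasCompactSupport_normed
  have hρ1 : ∫ x, ρ x = 1 := b.integral_normed
  refine ⟨∫ x, ρ x * f x, ae_eq_of_integral_contDiff_smul_eq h.1
    (continuous_const.locallyIntegrable) fun φ hφ hφc => ?_⟩
  have hiφ : Integrable φ := hφ.continuous.integrable_of_hasCompactSupport hφc
  have hiρ : Integrable ρ := hρ.continuous.integrable_of_hasCompactSupport hρc
  obtain ⟨η, hη, hηc, hd⟩ := exists_test_primitive (ψ := fun x => φ x - (∫ y, φ y) * ρ x)
    (hφ.sub (contDiff_const.mul hρ)) (hφc.sub hρc.mul_left)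
    (by rw [integral_sub hiφ (hiρ.const_mul _), integral_const_mul, hρ1, mul_one, sub_self])
  have key := h.2.2 η hη hηc
  have e1 : Integrable fun x => φ x * f x := integrable_test_smul h.1 hφ.continuous hφc
  have e2 : Integrable fun x => ρ x * f x := integrable_test_smul h.1 hρ.continuous hρc
  simp only [hd, smul_eq_mul, Pi.zero_apply, mul_zero, integral_zero, neg_zero, sub_mul,
    mul_assoc] at key
  rw [integral_sub e1 (e2.const_mul _), integral_const_mul] at key
  simp only [smul_eq_mul]
  rw [integral_mul_const]
  linarith

theorem HasWeakDeriv.exists_eq_primitive {f g : ℝ → ℝ} (h : HasWeakDeriv f g) :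
    ∃ C : ℝ, f =ᵐ[volume] fun x => C + ∫ t in (0 : ℝ)..x, g t := by
  have h1 := h.add ((hasWeakDeriv_primitive h.2.1).const_smul (-1))
  obtain ⟨C, hC⟩ := (h1.congr (EventuallyEq.refl _ _)
    (g' := 0) (ae_of_all _ fun x => by simp)).ae_const
  refine ⟨C, hC.mono fun x hx => ?_⟩
  simp only [Pi.add_apply, Pi.smul_apply, smul_eq_mul] at hx
  linarith

theorem HasWeakDeriv.exists_continuous {f g : ℝ → ℝ} (h : HasWeakDeriv f g) :
    ∃ φ : ℝ → ℝ, Continuous φ ∧ f =ᵐ[volume] φ := by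
  obtain ⟨C, hC⟩ := h.exists_eq_primitive
  exact ⟨_, continuous_const.add (continuous_primitive_of_locallyIntegrable h.2.1), hC⟩

/-- Continuity upgrades the almost everywhere identity with a primitive of `ψ` to an identity
everywhere; the fundamental theorem of calculus then applies. -/
theorem HasWeakDeriv.hasDerivAt {φ ψ : ℝ → ℝ} (h : HasWeakDeriv φ ψ) (hφ : Continuous φ)
    (hψ : Continuous ψ) (x : ℝ) : HasDerivAt φ (ψ x) x := by
  obtain ⟨C, hC⟩ := h.exists_eq_primitive
  rw [(hφ.ae_eq_iff_eq volume
    (continuous_const.add (continuous_primitive_of_locallyIntegrable h.2.1))).1 hC]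
  exact (intervalIntegral.integral_hasDerivAt_right (hψ.intervalIntegrable _ _)
      (hψ.stronglyMeasurableAtFilter _ _) hψ.continuousAt).const_add C

theorem MemH1.memLp_weakDeriv {f : ℝ → ℝ} (hf : MemH1 f) : MemLp (weakDeriv f) 2 volume := by
  rw [weakDeriv, dif_pos hf.2]
  exact hf.2.choose_spec.1

theorem MemH1.hasWeakDeriv {f : ℝ → ℝ} (hf : MemH1 f) : HasWeakDeriv f (weakDeriv f) := by
  rw [weakDeriv, dif_pos hf.2]
  exact hf.2.choose_spec.2

theorem memH1_of_hasWeakDeriv {f g : ℝ → ℝ} (hf : MemLp f 2 volume) (hg : MemLp g 2 volume)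
    (h : HasWeakDeriv f g) : MemH1 f := ⟨hf, g, hg, h⟩

/-- `weakDeriv` is an arbitrary choice of representative, so every computation with it goes through
this almost everywhere identification. -/
theorem MemH1.weakDeriv_ae_eq {f g : ℝ → ℝ} (hf : MemH1 f) (h : HasWeakDeriv f g) :
    weakDeriv f =ᵐ[volume] g := hf.hasWeakDeriv.unique h

theorem MemH1.add {f g : ℝ → ℝ} (hf : MemH1 f) (hg : MemH1 g) : MemH1 (f + g) :=
  memH1_of_hasWeakDeriv (hf.1.add hg.1) (hf.memLp_weakDeriv.add hg.memLp_weakDeriv)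
    (hf.hasWeakDeriv.add hg.hasWeakDeriv)

theorem MemH1.const_smul {f : ℝ → ℝ} (hf : MemH1 f) (c : ℝ) : MemH1 (c • f) :=
  memH1_of_hasWeakDeriv (hf.1.const_smul c) (hf.memLp_weakDeriv.const_smul c)
    (hf.hasWeakDeriv.const_smul c)

theorem memLp_two_test {η : ℝ → ℝ} (hη : Continuous η) (hc : HasCompactSupport η) :
    MemLp η 2 volume := hη.memLp_of_hasCompactSupport hc

theorem ae_zero_of_ae_const_of_memLp {f : ℝ → ℝ} (hf : MemLp f 2 volume) {C : ℝ}
    (h : f =ᵐ[volume] fun _ => C) : f =ᵐ[volume] 0 := by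
  have h1 : MemLp (fun _ : ℝ => C) 2 volume := (memLp_congr_ae h).1 hf
  rw [memLp_const_iff (by simp) (by simp)] at h1
  rcases h1 with h1 | h1
  · rw [h1] at h; exact h
  · simp at h1

end LSI

/-! ### Homogeneity and the equivalence of the two minimization problems. -/

namespace LSI

theorem cbrt_ne_zero {t : ℝ} (ht : t ≠ 0) : cbrt t ≠ 0 := fun h => ht <| by
  rw [← cbrt_pow_three t, h]; norm_num

theorem cbrt_one : cbrt 1 = 1 := by simp [cbrt]

theorem cbrt_pos {t : ℝ} (ht : 0 < t) : 0 < cbrt t := by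
  rw [cbrt, sign_pos ht]
  simpa using Real.rpow_pos_of_pos (abs_pos.2 ht.ne') _

theorem MemY.const_smul {N : ℕ} {Θ : Tuple N} (h : MemY Θ) (s : ℝ) : MemY (s • Θ) :=
  ⟨fun j => (h.1 j).const_smul s, h.2.const_smul s⟩

theorem MemY.add {N : ℕ} {Θ Θ' : Tuple N} (h : MemY Θ) (h' : MemY Θ') : MemY (Θ + Θ') :=
  ⟨fun j => (h.1 j).add (h'.1 j), h.2.add h'.2⟩

namespace Params

variable {N : ℕ} (p : Params N)

theorem K_smul {Θ : Tuple N} (h : MemY Θ) (s : ℝ) : p.K (s • Θ) = s ^ 2 * p.K Θ := by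
  unfold K
  rw [← integral_const_mul]
  refine integral_congr_ae ?_
  have h1 : ∀ᵐ x, ∀ j, weakDeriv (s • Θ.1 j) x = s * weakDeriv (Θ.1 j) x :=
    ae_all_iff.2 fun j =>
      ((h.1 j).const_smul s).weakDeriv_ae_eq ((h.1 j).hasWeakDeriv.const_smul s)
  filter_upwards [h1, (h.2.const_smul s).weakDeriv_ae_eq (h.2.hasWeakDeriv.const_smul s)]
    with x hx hx'
  simp only [Prod.smul_fst, Prod.smul_snd, Pi.smul_apply, hx, hx', smul_eq_mul, mul_add,
    Finset.mul_sum]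
  congr 1
  · exact Finset.sum_congr rfl fun j _ => by ring
  · ring

theorem F_smul (Θ : Tuple N) (s x : ℝ) : p.F (s • Θ) x = s ^ 3 * p.F Θ x := by
  simp only [F, Prod.smul_fst, Prod.smul_snd, Pi.smul_apply, smul_eq_mul, mul_pow]
  have : ∑ j, p.α j * (s ^ 2 * Θ.1 j x ^ 2) = s ^ 2 * ∑ j, p.α j * Θ.1 j x ^ 2 := by
    rw [Finset.mul_sum]
    exact Finset.sum_congr rfl fun j _ => by ring
  rw [this]
  ring

/-- No integrability is needed: if the density is not integrable, both integrals take the default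
value 0 or the factor is 0. -/
theorem intF_smul (Θ : Tuple N) (s : ℝ) : p.intF (s • Θ) = s ^ 3 * p.intF Θ := by
  simp only [intF, F_smul, integral_const_mul]

theorem intF_rescale {lam : ℝ} {Δ : Tuple N} (h : p.intF Δ ≠ 0) :
    p.intF (p.rescale lam Δ) = lam := by
  rw [rescale, intF_smul, div_pow, cbrt_pow_three, cbrt_pow_three, div_mul_cancel₀ _ h]

theorem K_rescale {Δ : Tuple N} (hY : MemY Δ) (lam : ℝ) :
    p.K (p.rescale lam Δ) = cbrt lam ^ 2 * p.Lam Δ := by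
  rw [rescale, K_smul p hY, Lam, div_pow]
  ring

theorem rescale_mem_admissible {Δ : Tuple N} (hY : MemY Δ) (h : p.intF Δ ≠ 0) (lam : ℝ) :
    p.rescale lam Δ ∈ p.admissible lam := ⟨hY.const_smul _, p.intF_rescale h⟩

theorem intF_eq_zero_of_AEEqual_zero {Θ : Tuple N} (h : AEEqual Θ 0) : p.intF Θ = 0 := by
  refine integral_eq_zero_of_ae ?_
  filter_upwards [h.2] with x hx'
  simp [F, hx']

theorem not_AEEqual_zero {Θ : Tuple N} (h : p.intF Θ ≠ 0) : ¬ AEEqual Θ 0 :=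
  fun h' => h (p.intF_eq_zero_of_AEEqual_zero h')

variable {p}

/-- Each competitor for the quotient is compared with `U` after being rescaled into the admissible
set. -/
theorem IsConstrainedMin.isQuotientMin {lam : ℝ} (hl : 0 < lam) {U : Tuple N}
    (hU : p.IsConstrainedMin lam U) : p.IsQuotientMin U := by
  have hF : p.intF U = lam := hU.1.2
  have hF0 : p.intF U ≠ 0 := by rw [hF]; exact hl.ne'
  refine ⟨⟨hU.1.1, p.not_AEEqual_zero hF0, hF0⟩, fun Θ' hY _ h0 => ?_⟩
  have h1 := hU.2 _ (p.rescale_mem_admissible hY h0 lam)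
  rw [p.K_rescale hY] at h1
  rw [Lam, hF, div_le_iff₀' (pow_pos (cbrt_pos hl) 2)]
  exact h1

theorem IsQuotientMin.isConstrainedMin_rescale {Δ : Tuple N} (hΔ : p.IsQuotientMin Δ)
    {lam : ℝ} (hl : 0 < lam) : p.IsConstrainedMin lam (p.rescale lam Δ) := by
  refine ⟨p.rescale_mem_admissible hΔ.1.1 hΔ.1.2.2 lam, fun Θ' hΘ' => ?_⟩
  have h0 : p.intF Θ' ≠ 0 := by rw [hΘ'.2]; exact hl.ne'
  have h1 := hΔ.2 Θ' hΘ'.1 (p.not_AEEqual_zero h0) h0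
  rw [p.K_rescale hΔ.1.1, ← le_div_iff₀' (pow_pos (cbrt_pos hl) 2)]
  rwa [Lam.eq_1 p Θ', hΘ'.2] at h1

theorem IsConstrainedMin.I_eq {lam : ℝ} {U : Tuple N} (hU : p.IsConstrainedMin lam U) :
    p.I lam = p.K U :=
  IsLeast.csInf_eq ⟨Set.mem_image_of_mem _ hU.1, Set.forall_mem_image.2 hU.2⟩

theorem IsQuotientMin.I_one {Δ : Tuple N} (hΔ : p.IsQuotientMin Δ) : p.I 1 = p.Lam Δ := by
  rw [(hΔ.isConstrainedMin_rescale one_pos).I_eq, p.K_rescale hΔ.1.1, cbrt_one]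
  ring

theorem IsConstrainedMin.profile_eq {lam : ℝ} (hl : 0 < lam) {U : Tuple N}
    (hU : p.IsConstrainedMin lam U) : p.profile U = (2 / 3 * p.I 1 / cbrt lam) • U := by
  rw [profile, (hU.isQuotientMin hl).I_one, hU.1.2]

theorem IsQuotientMin.profile_eq {Δ : Tuple N} (hΔ : p.IsQuotientMin Δ) {lam : ℝ}
    (hl : 0 < lam) : p.profile Δ = (2 / 3 * p.I 1 / cbrt lam) • p.rescale lam Δ := by
  rw [profile, rescale, smul_smul, hΔ.I_one]
  congr 1
  have := (cbrt_pos hl).ne'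
  field_simp

variable (p) in
theorem integrand_nonneg (hσ : 0 ≤ p.σ) (hc : 0 ≤ p.cτ) (hγ : 0 ≤ p.γ) (Θ : Tuple N) (x : ℝ) :
    0 ≤ (∑ j, (weakDeriv (Θ.1 j) x ^ 2 + p.σ * Θ.1 j x ^ 2)) +
      (p.γ * weakDeriv Θ.2 x ^ 2 + p.cτ * Θ.2 x ^ 2) := by
  have := Finset.sum_nonneg fun (j : Fin N) (_ : j ∈ Finset.univ) =>
    (by positivity : 0 ≤ weakDeriv (Θ.1 j) x ^ 2 + p.σ * Θ.1 j x ^ 2)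
  positivity

variable (p) in
theorem K_nonneg (hσ : 0 ≤ p.σ) (hc : 0 ≤ p.cτ) (hγ : 0 ≤ p.γ) (Θ : Tuple N) : 0 ≤ p.K Θ :=
  integral_nonneg fun x => p.integrand_nonneg hσ hc hγ Θ x

variable (p) in
theorem integrable_K_integrand {Θ : Tuple N} (h : MemY Θ) :
    Integrable fun x => (∑ j, (weakDeriv (Θ.1 j) x ^ 2 + p.σ * Θ.1 j x ^ 2)) +
      (p.γ * weakDeriv Θ.2 x ^ 2 + p.cτ * Θ.2 x ^ 2) :=
  (integrable_finsetSum _ fun j _ => (h.1 j).memLp_weakDeriv.integrable_sq.add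
    ((h.1 j).1.integrable_sq.const_mul _)).add
    ((h.2.memLp_weakDeriv.integrable_sq.const_mul _).add (h.2.1.integrable_sq.const_mul _))

variable (p) in
-- Since `cτ` may be 0, only the term `γ (g')²` controls `g`. If `K` vanishes, then `g' = 0`, so `g`
-- is a square integrable constant, hence 0; every term of `F` contains `g`.
theorem K_pos (hσ : 0 ≤ p.σ) (hc : 0 ≤ p.cτ) (hγ : 0 < p.γ) {Θ : Tuple N} (h : MemY Θ)
    (hF : p.intF Θ ≠ 0) : 0 < p.K Θ := by
  refine lt_of_le_of_ne (p.K_nonneg hσ hc hγ.le Θ) fun h0 => hF ?_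
  have h1 := (integral_eq_zero_iff_of_nonneg (p.integrand_nonneg hσ hc hγ.le Θ)
    (p.integrable_K_integrand h)).1 h0.symm
  have h2 : weakDeriv Θ.2 =ᵐ[volume] 0 := by
    filter_upwards [h1] with x hx
    have := Finset.sum_nonneg fun (j : Fin N) (_ : j ∈ Finset.univ) =>
      (by positivity : 0 ≤ weakDeriv (Θ.1 j) x ^ 2 + p.σ * Θ.1 j x ^ 2)
    have h3 : 0 ≤ p.γ * weakDeriv Θ.2 x ^ 2 := by positivity
    have h4 : 0 ≤ p.cτ * Θ.2 x ^ 2 := by positivity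
    simp only [Pi.zero_apply] at hx ⊢
    have h5 : p.γ * weakDeriv Θ.2 x ^ 2 = 0 := by linarith
    simpa [hγ.ne'] using h5
  obtain ⟨C, hC⟩ := (h.2.hasWeakDeriv.congr (EventuallyEq.refl _ _) h2).ae_const
  refine integral_eq_zero_of_ae ?_
  filter_upwards [ae_zero_of_ae_const_of_memLp h.2.1 hC] with x hx
  simp [F, hx]

theorem IsQuotientMin.Lam_pos (hσ : 0 ≤ p.σ) (hc : 0 ≤ p.cτ) (hγ : 0 < p.γ) {Δ : Tuple N}
    (hΔ : p.IsQuotientMin Δ) : 0 < p.Lam Δ :=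
  div_pos (p.K_pos hσ hc hγ hΔ.1.1 hΔ.1.2.2)
    (by have := cbrt_ne_zero hΔ.1.2.2; positivity)

/-- Cubing removes the cube root and admits competitors with `intF = 0`, so variations need no case
distinction. -/
theorem IsQuotientMin.pow_three_le (hσ : 0 ≤ p.σ) (hc : 0 ≤ p.cτ) (hγ : 0 < p.γ) {Δ : Tuple N}
    (hΔ : p.IsQuotientMin Δ) {Θ : Tuple N} (hY : MemY Θ) :
    p.Lam Δ ^ 3 * p.intF Θ ^ 2 ≤ p.K Θ ^ 3 := by
  by_cases h0 : p.intF Θ = 0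
  · rw [h0]
    simpa using pow_nonneg (p.K_nonneg hσ hc hγ.le Θ) 3
  · have h1 := hΔ.2 Θ hY (p.not_AEEqual_zero h0) h0
    have h2 := cbrt_ne_zero h0
    rw [Lam.eq_1 p Θ, le_div_iff₀ (by positivity)] at h1
    have h3 := pow_le_pow_left₀ (mul_nonneg (hΔ.Lam_pos hσ hc hγ).le (sq_nonneg _)) h1 3
    calc p.Lam Δ ^ 3 * p.intF Θ ^ 2 = p.Lam Δ ^ 3 * (cbrt (p.intF Θ) ^ 3) ^ 2 := by
          rw [cbrt_pow_three]
      _ = (p.Lam Δ * cbrt (p.intF Θ) ^ 2) ^ 3 := by ring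
      _ ≤ _ := h3

/-- Together with `intF_profile` this gives `K = (3/2) intF` at the profile, the ratio that removes
the multiplier from the Euler–Lagrange equation. -/
theorem IsQuotientMin.K_profile {Δ : Tuple N} (hΔ : p.IsQuotientMin Δ) :
    p.K (p.profile Δ) = 4 / 9 * p.Lam Δ ^ 3 := by
  rw [profile, K_smul p hΔ.1.1]
  have h2 := cbrt_ne_zero hΔ.1.2.2
  have : p.K Δ = p.Lam Δ * cbrt (p.intF Δ) ^ 2 := by
    rw [Lam, div_mul_cancel₀ _ (by positivity)]
  rw [this]
  field_simp
  ring

theorem IsQuotientMin.intF_profile {Δ : Tuple N} (hΔ : p.IsQuotientMin Δ) :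
    p.intF (p.profile Δ) = 8 / 27 * p.Lam Δ ^ 3 := by
  rw [profile, intF_smul, div_pow, cbrt_pow_three, div_mul_cancel₀ _ hΔ.1.2.2]
  ring

theorem IsQuotientMin.memY_profile {Δ : Tuple N} (hΔ : p.IsQuotientMin Δ) :
    MemY (p.profile Δ) := hΔ.1.1.const_smul _

end Params

end LSI

/-! ### First variation and the weak Euler–Lagrange equations. -/

namespace LSI

theorem hasWeakDeriv_test {η : ℝ → ℝ} (hη : ContDiff ℝ ∞ η) : HasWeakDeriv η (deriv η) :=
  hasWeakDeriv_of_hasDerivAt (fun x => (hη.differentiable (by simp) x).hasDerivAt)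
    (hη.continuous_deriv (by simp))

theorem memLp_two_deriv_test {η : ℝ → ℝ} (hη : ContDiff ℝ ∞ η) (hc : HasCompactSupport η) :
    MemLp (deriv η) 2 volume :=
  memLp_two_test (hη.continuous_deriv (by simp)) hc.deriv

theorem memH1_test {η : ℝ → ℝ} (hη : ContDiff ℝ ∞ η) (hc : HasCompactSupport η) : MemH1 η :=
  memH1_of_hasWeakDeriv (memLp_two_test hη.continuous hc) (memLp_two_deriv_test hη hc)
    (hasWeakDeriv_test hη)

theorem MemH1.weakDeriv_add_test {f η : ℝ → ℝ} (hf : MemH1 f) (hη : ContDiff ℝ ∞ η)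
    (hc : HasCompactSupport η) (s : ℝ) :
    ∀ᵐ x, weakDeriv (f + s • η) x = weakDeriv f x + s * deriv η x :=
  (hf.add ((memH1_test hη hc).const_smul s)).weakDeriv_ae_eq
    (hf.hasWeakDeriv.add ((hasWeakDeriv_test hη).const_smul s))

/-- The tuple `(a₁ η, …, a_N η, b η)`. -/
def multiples {N : ℕ} (a : Fin N → ℝ) (b : ℝ) (η : ℝ → ℝ) : Tuple N := (fun j => a j • η, b • η)

theorem memY_multiples {N : ℕ} (a : Fin N → ℝ) (b : ℝ) {η : ℝ → ℝ} (hη : ContDiff ℝ ∞ η)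
    (hc : HasCompactSupport η) : MemY (multiples a b η) :=
  ⟨fun j => (memH1_test hη hc).const_smul (a j), (memH1_test hη hc).const_smul b⟩

/-- The difference of the two sides of `h` is a nonnegative polynomial in `t` that vanishes at 0, so
its derivative there is 0. Only the linear coefficients `A` and `B` enter. -/
theorem stationary_of_nonneg {k f B A r r' s M : ℝ} (h0 : k ^ 3 = M * f ^ 2)
    (h : ∀ t : ℝ, M * (f + t * A + t ^ 2 * r' + t ^ 3 * s) ^ 2 ≤
      (k + t * B + t ^ 2 * r) ^ 3) :
    3 * k ^ 2 * B = 2 * M * f * A := by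
  have hid := hasDerivAt_id' (0 : ℝ)
  have h1 : HasDerivAt (fun t : ℝ => k + t * B + t ^ 2 * r) B 0 := by
    convert! ((hid.mul_const B).const_add k).add ((hid.pow 2).mul_const r) using 1
    simp
  have h2 : HasDerivAt (fun t : ℝ => f + t * A + t ^ 2 * r' + t ^ 3 * s) A 0 := by
    convert! (((hid.mul_const A).const_add f).add ((hid.pow 2).mul_const r')).add
      ((hid.pow 3).mul_const s) using 1
    simp
  have h3 := (h1.pow 3).sub ((h2.pow 2).const_mul M)
  have h4 := IsLocalMin.hasDerivAt_eq_zero (a := 0) (Filter.Eventually.of_forall fun t => ?_) h3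
  · norm_num at h4
    linarith
  · have := h t
    simp only [Pi.sub_apply, Pi.pow_apply]
    norm_num
    linarith

theorem integral_linear_combination {f g h k : ℝ → ℝ} (hf : Integrable f) (hg : Integrable g)
    (hh : Integrable h) (hk : Integrable k) (r s t : ℝ) :
    ∫ x, (f x + r * g x + s * h x + t * k x) =
      (∫ x, f x) + r * (∫ x, g x) + s * (∫ x, h x) + t * ∫ x, k x := by
  have i1 : Integrable fun x => f x + r * g x := hf.add (hg.const_mul r)
  have i2 : Integrable fun x => f x + r * g x + s * h x := i1.add (hh.const_mul s)
  rw [integral_add i2 (hk.const_mul t), integral_add i1 (hh.const_mul s),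
    integral_add hf (hg.const_mul r), integral_const_mul, integral_const_mul, integral_const_mul]

namespace Params

variable {N : ℕ} (p : Params N)

/-- The flux in the Euler--Lagrange equation in the direction `(a₁, …, a_N, b)`. -/
noncomputable def flux (Θ : Tuple N) (a : Fin N → ℝ) (b : ℝ) (x : ℝ) : ℝ :=
  (∑ j, a j * weakDeriv (Θ.1 j) x) + p.γ * b * weakDeriv Θ.2 x

/-- The linear zeroth-order term in the direction `(a₁, …, a_N, b)`. -/
noncomputable def linTerm (Θ : Tuple N) (a : Fin N → ℝ) (b : ℝ) (x : ℝ) : ℝ :=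
  p.σ * (∑ j, a j * Θ.1 j x) + p.cτ * b * Θ.2 x

/-- The derivative of the density `F` at `Θ` in the direction `(a₁, …, a_N, b)`. -/
noncomputable def dF (Θ : Tuple N) (a : Fin N → ℝ) (b : ℝ) (x : ℝ) : ℝ :=
  p.β * Θ.2 x ^ 2 * b + 2 * (∑ j, p.α j * a j * Θ.1 j x) * Θ.2 x +
    (∑ j, p.α j * Θ.1 j x ^ 2) * b

theorem locallyIntegrable_of_memLp_two {f : ℝ → ℝ} (hf : MemLp f 2 volume) :
    LocallyIntegrable f volume := hf.locallyIntegrable (by norm_num)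

variable {p}

theorem locallyIntegrable_flux {Θ : Tuple N} (h : MemY Θ) (a : Fin N → ℝ) (b : ℝ) :
    LocallyIntegrable (p.flux Θ a b) volume :=
  locallyIntegrable_of_memLp_two <|
    (memLp_finsetSum _ fun j _ => (h.1 j).memLp_weakDeriv.const_mul (a j)).add
      (h.2.memLp_weakDeriv.const_mul _)

theorem locallyIntegrable_linTerm {Θ : Tuple N} (h : MemY Θ) (a : Fin N → ℝ) (b : ℝ) :
    LocallyIntegrable (p.linTerm Θ a b) volume :=
  locallyIntegrable_of_memLp_two <|
    ((memLp_finsetSum _ fun j _ => (h.1 j).1.const_mul (a j)).const_mul _).add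
      (h.2.1.const_mul _)

theorem locallyIntegrable_dF {Θ : Tuple N} (h : MemY Θ) (a : Fin N → ℝ) (b : ℝ) :
    LocallyIntegrable (p.dF Θ a b) volume := by
  refine Integrable.locallyIntegrable ?_
  refine (((h.2.1.integrable_sq.const_mul _).mul_const _).add ?_).add
    ((integrable_finsetSum _ fun j _ => (h.1 j).1.integrable_sq.const_mul _).mul_const b)
  exact MemLp.integrable_mul
    ((memLp_finsetSum _ fun j _ => (h.1 j).1.const_mul (p.α j * a j)).const_mul 2) h.2.1

theorem K_add_multiples {Θ : Tuple N} (h : MemY Θ) (a : Fin N → ℝ) (b : ℝ) {η : ℝ → ℝ}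
    (hη : ContDiff ℝ ∞ η) (hc : HasCompactSupport η) :
    ∃ r, ∀ t : ℝ, p.K (Θ + t • multiples a b η) = p.K Θ +
      t * (2 * ((∫ x, deriv η x * p.flux Θ a b x) + ∫ x, η x * p.linTerm Θ a b x)) +
      t ^ 2 * r := by
  refine ⟨∫ x, (((∑ j, a j ^ 2) + p.γ * b ^ 2) * deriv η x ^ 2 +
    (p.σ * (∑ j, a j ^ 2) + p.cτ * b ^ 2) * η x ^ 2), fun t => ?_⟩
  have i1 := p.integrable_K_integrand h
  have i2 : Integrable fun x => deriv η x * p.flux Θ a b x :=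
    integrable_deriv_test_smul (locallyIntegrable_flux h a b) hη hc
  have i3 : Integrable fun x => η x * p.linTerm Θ a b x :=
    integrable_test_smul (locallyIntegrable_linTerm h a b) hη.continuous hc
  have i4 : Integrable fun x => (((∑ j, a j ^ 2) + p.γ * b ^ 2) * deriv η x ^ 2 +
    (p.σ * (∑ j, a j ^ 2) + p.cτ * b ^ 2) * η x ^ 2) :=
    ((memLp_two_deriv_test hη hc).integrable_sq.const_mul _).add
      ((memLp_two_test hη.continuous hc).integrable_sq.const_mul _)
  unfold K
  have e0 := integral_linear_combination i1 i2 i3 i4 (2 * t) (2 * t) (t ^ 2)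
  rw [mul_left_comm, ← mul_assoc, mul_add, ← add_assoc, ← e0]
  refine integral_congr_ae ?_
  have h1 : ∀ᵐ x, ∀ j, weakDeriv (Θ.1 j + (t * a j) • η) x =
      weakDeriv (Θ.1 j) x + t * a j * deriv η x :=
    ae_all_iff.2 fun j => (h.1 j).weakDeriv_add_test hη hc (t * a j)
  filter_upwards [h1, h.2.weakDeriv_add_test hη hc (t * b)] with x hx hx'
  have e1 : ∀ j, (Θ + t • multiples a b η).1 j = Θ.1 j + (t * a j) • η := fun j => by
    simp [multiples, smul_smul]
  have e2 : (Θ + t • multiples a b η).2 = Θ.2 + (t * b) • η := by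
    simp [multiples, smul_smul]
  simp only [e1, e2, hx, hx', Pi.add_apply, Pi.smul_apply, smul_eq_mul, flux, linTerm]
  have e3 : ∑ j, ((weakDeriv (Θ.1 j) x + t * a j * deriv η x) ^ 2 +
        p.σ * (Θ.1 j x + t * a j * η x) ^ 2) =
      ∑ j, (weakDeriv (Θ.1 j) x ^ 2 + p.σ * Θ.1 j x ^ 2) +
      2 * t * deriv η x * ∑ j, a j * weakDeriv (Θ.1 j) x +
      2 * t * p.σ * η x * ∑ j, a j * Θ.1 j x +
      t ^ 2 * (deriv η x ^ 2 + p.σ * η x ^ 2) * ∑ j, a j ^ 2 := by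
    simp only [Finset.mul_sum, ← Finset.sum_add_distrib]
    exact Finset.sum_congr rfl fun j _ => by ring
  rw [e3]
  ring

theorem intF_add_multiples {Θ : Tuple N} (h : MemY Θ) (hF : p.intF Θ ≠ 0) (a : Fin N → ℝ)
    (b : ℝ) {η : ℝ → ℝ} (hη : ContDiff ℝ ∞ η) (hc : HasCompactSupport η) :
    ∃ r s, ∀ t : ℝ, p.intF (Θ + t • multiples a b η) = p.intF Θ +
      t * (∫ x, η x * p.dF Θ a b x) + t ^ 2 * r + t ^ 3 * s := by
  set c : ℝ → ℝ := fun x => (p.β * b ^ 2 + ∑ j, p.α j * a j ^ 2) * Θ.2 x +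
    2 * b * ∑ j, p.α j * a j * Θ.1 j x with hcdef
  set d : ℝ := 1 / 3 * p.β * b ^ 3 + (∑ j, p.α j * a j ^ 2) * b with hd
  refine ⟨∫ x, η x ^ 2 * c x, ∫ x, d * η x ^ 3, fun t => ?_⟩
  have i1 : Integrable (p.F Θ) := by
    -- A non-integrable density would have integral 0 by default, so `hF` supplies the integrability
    -- and no Sobolev embedding is required.
    by_contra hi
    exact hF (integral_undef hi)
  have i2 : Integrable fun x => η x * p.dF Θ a b x :=
    integrable_test_smul (locallyIntegrable_dF h a b) hη.continuous hc
  have hcl : LocallyIntegrable c volume :=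
    locallyIntegrable_of_memLp_two <| (h.2.1.const_mul _).add
      ((memLp_finsetSum _ fun j _ => (h.1 j).1.const_mul (p.α j * a j)).const_mul _)
  have hp : ∀ n : ℕ, n ≠ 0 → HasCompactSupport fun x => η x ^ n := fun n hn =>
    hc.comp_left (g := fun y : ℝ => y ^ n) (zero_pow hn)
  have i3 : Integrable fun x => η x ^ 2 * c x :=
    integrable_test_smul hcl (hη.continuous.pow 2) (hp 2 two_ne_zero)
  have i4 : Integrable fun x => d * η x ^ 3 :=
    ((hη.continuous.pow 3).integrable_of_hasCompactSupport (hp 3 three_ne_zero)).const_mul d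
  unfold intF
  rw [← integral_linear_combination i1 i2 i3 i4 t (t ^ 2) (t ^ 3)]
  refine integral_congr_ae (ae_of_all _ fun x => ?_)
  simp only [F, multiples, dF, hcdef, hd, Prod.fst_add, Prod.snd_add, Prod.smul_fst,
    Prod.smul_snd, Pi.add_apply, Pi.smul_apply, smul_eq_mul]
  have e : ∑ j, p.α j * (Θ.1 j x + t * (a j * η x)) ^ 2 =
      ∑ j, p.α j * Θ.1 j x ^ 2 + 2 * t * η x * ∑ j, p.α j * a j * Θ.1 j x +
      t ^ 2 * η x ^ 2 * ∑ j, p.α j * a j ^ 2 := by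
    simp only [Finset.mul_sum, ← Finset.sum_add_distrib]
    exact Finset.sum_congr rfl fun j _ => by ring
  rw [e]
  ring

/-- Stationarity in the direction `(a₁ η, …, a_N η, b η)` for all test functions `η` is exactly a
weak derivative statement; all component equations are handled at once. -/
theorem IsQuotientMin.hasWeakDeriv_flux (hσ : 0 ≤ p.σ) (hc : 0 ≤ p.cτ) (hγ : 0 < p.γ)
    {Δ : Tuple N} (hΔ : p.IsQuotientMin Δ) (a : Fin N → ℝ) (b : ℝ) :
    HasWeakDeriv (p.flux (p.profile Δ) a b)
      (fun x => p.linTerm (p.profile Δ) a b x - 1 / 2 * p.dF (p.profile Δ) a b x) := by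
  have hY := hΔ.memY_profile
  have hL := hΔ.Lam_pos hσ hc hγ
  have hF : p.intF (p.profile Δ) ≠ 0 := by rw [hΔ.intF_profile]; positivity
  have l1 := locallyIntegrable_flux (p := p) hY a b
  have l2 := locallyIntegrable_linTerm (p := p) hY a b
  have l3 := locallyIntegrable_dF (p := p) hY a b
  refine ⟨l1, l2.sub (l3.smul (1 / 2 : ℝ)), fun η hη hηc => ?_⟩
  obtain ⟨r, hr⟩ := K_add_multiples (p := p) hY a b hη hηc
  obtain ⟨r', s, hs⟩ := intF_add_multiples hY hF a b hη hηc
  have key := stationary_of_nonneg (k := p.K (p.profile Δ)) (f := p.intF (p.profile Δ))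
    (M := p.Lam Δ ^ 3) (r := r) (r' := r') (s := s)
    (by rw [hΔ.K_profile, hΔ.intF_profile]; ring) (fun t => by
      rw [← hr t, ← hs t]
      exact hΔ.pow_three_le hσ hc hγ (hY.add ((memY_multiples a b hη hηc).const_smul t)))
  rw [hΔ.K_profile, hΔ.intF_profile] at key
  have i2 : Integrable fun x => η x * p.linTerm (p.profile Δ) a b x :=
    integrable_test_smul l2 hη.continuous hηc
  have i3 : Integrable fun x => η x * p.dF (p.profile Δ) a b x :=
    integrable_test_smul l3 hη.continuous hηc
  have e : ∫ x, η x * (p.linTerm (p.profile Δ) a b x - 1 / 2 * p.dF (p.profile Δ) a b x) =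
      (∫ x, η x * p.linTerm (p.profile Δ) a b x) -
        1 / 2 * ∫ x, η x * p.dF (p.profile Δ) a b x := by
    rw [← integral_const_mul, ← integral_sub i2 (i3.const_mul _)]
    exact integral_congr_ae (ae_of_all _ fun x => by ring)
  simp only [smul_eq_mul]
  rw [e]
  have h6 : p.Lam Δ ^ 6 ≠ 0 := by positivity
  refine mul_left_cancel₀ h6 ?_
  -- With the values of `K` and `intF` inserted, `key` has coefficient `3 · (4/9)² · 2 = 32/27` on
  -- the left and `2 · 8/27 = 16/27` on the right, both times `Lam Δ ^ 6`.
  linear_combination (27 / 32) * key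

theorem IsQuotientMin.hasWeakDeriv_fst (hσ : 0 ≤ p.σ) (hc : 0 ≤ p.cτ) (hγ : 0 < p.γ)
    {Δ : Tuple N} (hΔ : p.IsQuotientMin Δ) (j : Fin N) :
    HasWeakDeriv (weakDeriv ((p.profile Δ).1 j))
      (fun x => p.σ * (p.profile Δ).1 j x - p.α j * (p.profile Δ).1 j x * (p.profile Δ).2 x) := by
  refine (hΔ.hasWeakDeriv_flux hσ hc hγ (Pi.single j 1) 0).congr (ae_of_all _ fun x => ?_)
    (ae_of_all _ fun x => ?_)
  · simp [flux, Pi.single_apply]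
  · simp [linTerm, dF, Pi.single_apply]
    ring

theorem IsQuotientMin.hasWeakDeriv_snd (hσ : 0 ≤ p.σ) (hc : 0 ≤ p.cτ) (hγ : 0 < p.γ)
    {Δ : Tuple N} (hΔ : p.IsQuotientMin Δ) :
    HasWeakDeriv (weakDeriv (p.profile Δ).2)
      (fun x => p.γ⁻¹ * (p.cτ * (p.profile Δ).2 x - 1 / 2 * (p.β * (p.profile Δ).2 x ^ 2 +
        ∑ j, p.α j * (p.profile Δ).1 j x ^ 2))) := by
  refine ((hΔ.hasWeakDeriv_flux hσ hc hγ 0 1).const_smul p.γ⁻¹).congr (ae_of_all _ fun x => ?_)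
    (ae_of_all _ fun x => ?_)
  · simp [flux, hγ.ne']
  · simp [linTerm, dF]

end Params

end LSI

/-! ### Classical solutions, decay and the travelling wave. -/

namespace LSI

/-- Both `f²` and its derivative `2ff'` are integrable, which forces `f²` to tend to 0 at both ends.
-/
theorem tendsto_cocompact_of_memLp_two {f f' : ℝ → ℝ} (h : ∀ x, HasDerivAt f (f' x) x)
    (hf : MemLp f 2 volume) (hf' : MemLp f' 2 volume) : Tendsto f (cocompact ℝ) (𝓝 0) := by
  have hd : ∀ x, HasDerivAt (fun y => f y ^ 2) (2 * (f x * f' x)) x := fun x => by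
    convert! (h x).pow 2 using 1
    norm_num
    ring
  have hi' : Integrable fun x => 2 * (f x * f' x) := (MemLp.integrable_mul hf hf').const_mul 2
  have hsq : Tendsto (fun x => f x ^ 2) (cocompact ℝ) (𝓝 0) := by
    rw [cocompact_eq_atBot_atTop, tendsto_sup]
    exact ⟨tendsto_zero_of_hasDerivAt_of_integrableOn_Iic (a := 0) (fun x _ => hd x)
        hi'.integrableOn hf.integrable_sq.integrableOn,
      tendsto_zero_of_hasDerivAt_of_integrableOn_Ioi (a := 0) (fun x _ => hd x)
        hi'.integrableOn hf.integrable_sq.integrableOn⟩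
  rw [tendsto_zero_iff_norm_tendsto_zero]
  have := hsq.sqrt
  simpa [Real.sqrt_sq_eq_abs] using this

theorem norm_exp_phase (c x : ℝ) : ‖Complex.exp (Complex.I * c * x / 2)‖ = 1 := by
  have : Complex.I * c * x / 2 = ((c * x / 2 : ℝ) : ℂ) * Complex.I := by push_cast; ring
  rw [this, Complex.norm_exp_ofReal_mul_I]

theorem hasDerivAt_exp_phase (c x : ℝ) :
    HasDerivAt (fun y : ℝ => Complex.exp (Complex.I * c * y / 2))
      (Complex.exp (Complex.I * c * x / 2) * (Complex.I * c / 2)) x := by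
  have h1 : HasDerivAt (fun y : ℝ => Complex.I * c * (y : ℂ) / 2) (Complex.I * c / 2) x := by
    convert! ((Complex.ofRealCLM.hasDerivAt (x := x)).const_mul (Complex.I * c)).div_const 2 using 1
    simp
  exact h1.cexp

theorem hasDerivAt_phase_mul {c x : ℝ} {f : ℝ → ℂ} {f' : ℂ} (h : HasDerivAt f f' x) :
    HasDerivAt (fun y : ℝ => Complex.exp (Complex.I * c * y / 2) * f y)
      (Complex.exp (Complex.I * c * x / 2) * (Complex.I * c / 2 * f x + f')) x := by
  convert! (hasDerivAt_exp_phase c x).mul h using 1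
  ring

theorem memLp_phase_mul (c : ℝ) {f : ℝ → ℂ} (hf : MemLp f 2 volume) :
    MemLp (fun x : ℝ => Complex.exp (Complex.I * c * x / 2) * f x) 2 volume := by
  refine hf.of_le (AEStronglyMeasurable.mul ?_ hf.1) (ae_of_all _ fun x => ?_)
  · exact (by fun_prop : Continuous fun x : ℝ => Complex.exp (Complex.I * c * x / 2)).aestronglyMeasurable
  · rw [norm_mul, norm_exp_phase, one_mul]

namespace Params

variable {N : ℕ} {p : Params N}

/-- A classical first-order form of the solitary-wave system: `q` and `s` are the derivatives of
the profiles, and all functions are square integrable. -/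
structure IsProfile (p : Params N) (φ q : Fin N → ℝ → ℝ) (ψ s : ℝ → ℝ) : Prop where
  memLp_φ : ∀ j, MemLp (φ j) 2 volume
  memLp_q : ∀ j, MemLp (q j) 2 volume
  memLp_ψ : MemLp ψ 2 volume
  memLp_s : MemLp s 2 volume
  deriv_φ : ∀ j x, HasDerivAt (φ j) (q j x) x
  deriv_ψ : ∀ x, HasDerivAt ψ (s x) x
  deriv_q : ∀ j x, HasDerivAt (q j) (p.σ * φ j x - p.α j * φ j x * ψ x) x
  deriv_s : ∀ x, HasDerivAt s
    (p.γ⁻¹ * (p.cτ * ψ x - 1 / 2 * (p.β * ψ x ^ 2 + ∑ j, p.α j * φ j x ^ 2))) x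

/-- By the Euler–Lagrange equations the weak derivatives of the profile are themselves weakly
differentiable, so they too have continuous representatives; with these the equations hold
pointwise. -/
theorem IsQuotientMin.exists_isProfile (hσ : 0 ≤ p.σ) (hc : 0 ≤ p.cτ) (hγ : 0 < p.γ)
    {Δ : Tuple N} (hΔ : p.IsQuotientMin Δ) :
    ∃ φ q ψ s, p.IsProfile φ q ψ s ∧ AEEqual (p.profile Δ) (φ, ψ) := by
  have hY := hΔ.memY_profile
  choose φ hφ hφe using fun j => (hY.1 j).hasWeakDeriv.exists_continuous
  choose q hq hqe using fun j => (hΔ.hasWeakDeriv_fst hσ hc hγ j).exists_continuous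
  obtain ⟨ψ, hψ, hψe⟩ := hY.2.hasWeakDeriv.exists_continuous
  obtain ⟨s, hs, hse⟩ := (hΔ.hasWeakDeriv_snd hσ hc hγ).exists_continuous
  refine ⟨φ, q, ψ, s, ⟨fun j => (memLp_congr_ae (hφe j)).1 (hY.1 j).1,
    fun j => (memLp_congr_ae (hqe j)).1 (hY.1 j).memLp_weakDeriv,
    (memLp_congr_ae hψe).1 hY.2.1, (memLp_congr_ae hse).1 hY.2.memLp_weakDeriv,
    fun j => ((hY.1 j).hasWeakDeriv.congr (hφe j) (hqe j)).hasDerivAt (hφ j) (hq j),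
    (hY.2.hasWeakDeriv.congr hψe hse).hasDerivAt hψ hs, fun j => ?_, ?_⟩, hφe, hψe⟩
  · refine ((hΔ.hasWeakDeriv_fst hσ hc hγ j).congr (hqe j) ?_).hasDerivAt (hq j) (by fun_prop)
    filter_upwards [hφe j, hψe] with x hx hx'
    rw [hx, hx']
  · refine ((hΔ.hasWeakDeriv_snd hσ hc hγ).congr hse ?_).hasDerivAt hs (by fun_prop)
    filter_upwards [ae_all_iff.2 hφe, hψe] with x hx hx'
    simp only [hx, hx']

namespace IsProfile

variable {φ q : Fin N → ℝ → ℝ} {ψ s : ℝ → ℝ}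

/-- Bootstrapping: the derivatives of `φ`, `q`, `ψ`, `s` are polynomials in these same functions, so
each round gains one derivative. -/
theorem contDiff_nat (h : p.IsProfile φ q ψ s) (n : ℕ) :
    (∀ j, ContDiff ℝ n (φ j) ∧ ContDiff ℝ n (q j)) ∧ ContDiff ℝ n ψ ∧ ContDiff ℝ n s := by
  have step : ∀ {m : ℕ} {f f' : ℝ → ℝ}, (∀ x, HasDerivAt f (f' x) x) → ContDiff ℝ m f' →
      ContDiff ℝ (m + 1 : ℕ) f := fun {m f f'} hf hf' => by
    push_cast
    rw [contDiff_succ_iff_deriv, (funext fun x => (hf x).deriv : deriv f = f')]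
    exact ⟨fun x => (hf x).differentiableAt, by simp, hf'⟩
  induction n with
  | zero =>
    simp only [Nat.cast_zero, contDiff_zero]
    exact ⟨fun j => ⟨continuous_iff_continuousAt.2 fun x => (h.deriv_φ j x).continuousAt,
      continuous_iff_continuousAt.2 fun x => (h.deriv_q j x).continuousAt⟩,
      continuous_iff_continuousAt.2 fun x => (h.deriv_ψ x).continuousAt,
      continuous_iff_continuousAt.2 fun x => (h.deriv_s x).continuousAt⟩
  | succ n ih =>
    obtain ⟨h1, h2, h3⟩ := ih
    refine ⟨fun j => ⟨step (h.deriv_φ j) (h1 j).2, step (h.deriv_q j) ?_⟩, step h.deriv_ψ h3,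
      step h.deriv_s ?_⟩
    · have := (h1 j).1
      fun_prop
    · have := fun j => (h1 j).1
      fun_prop

theorem contDiff_φ (h : p.IsProfile φ q ψ s) (j : Fin N) : ContDiff ℝ ∞ (φ j) :=
  contDiff_infty.2 fun n => ((h.contDiff_nat n).1 j).1

theorem contDiff_ψ (h : p.IsProfile φ q ψ s) : ContDiff ℝ ∞ ψ :=
  contDiff_infty.2 fun n => (h.contDiff_nat n).2.1

theorem contDiff_q (h : p.IsProfile φ q ψ s) (j : Fin N) : ContDiff ℝ ∞ (q j) :=
  contDiff_infty.2 fun n => ((h.contDiff_nat n).1 j).2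

theorem contDiff_s (h : p.IsProfile φ q ψ s) : ContDiff ℝ ∞ s :=
  contDiff_infty.2 fun n => (h.contDiff_nat n).2.2

theorem solvesODE (h : p.IsProfile φ q ψ s) (hγ : p.γ ≠ 0) : p.SolvesODE (φ, ψ) := by
  refine ⟨h.contDiff_φ, h.contDiff_ψ, fun j x => ?_, fun x => ?_⟩
  · rw [(funext fun x => (h.deriv_φ j x).deriv : deriv (φ j) = q j), (h.deriv_q j x).deriv]
    ring
  · rw [(funext fun x => (h.deriv_ψ x).deriv : deriv ψ = s), (h.deriv_s x).deriv,
      mul_inv_cancel_left₀ hγ]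
    ring

theorem schroedinger (h : p.IsProfile φ q ψ s) (j : Fin N) (x t : ℝ) :
    Complex.I * deriv (fun r : ℝ => Complex.exp (Complex.I * p.om * r) *
        (Complex.exp (Complex.I * p.c * ((x - p.c * r : ℝ) : ℂ) / 2) * (φ j (x - p.c * r) : ℂ))) t +
      deriv (deriv fun y : ℝ => Complex.exp (Complex.I * p.om * t) *
        (Complex.exp (Complex.I * p.c * ((y - p.c * t : ℝ) : ℂ) / 2) * (φ j (y - p.c * t) : ℂ))) x =
    -(p.α j : ℂ) * (Complex.exp (Complex.I * p.om * t) *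
        (Complex.exp (Complex.I * p.c * ((x - p.c * t : ℝ) : ℂ) / 2) * (φ j (x - p.c * t) : ℂ))) *
      (ψ (x - p.c * t) : ℂ) := by
  have d1 := fun y => hasDerivAt_phase_mul (c := p.c) (h.deriv_φ j y).ofReal_comp
  have d2 := fun y => hasDerivAt_phase_mul (c := p.c)
    (((h.deriv_φ j y).ofReal_comp.const_mul (Complex.I * p.c / 2)).add
      (h.deriv_q j y).ofReal_comp)
  have dt : HasDerivAt (fun r : ℝ => Complex.exp (Complex.I * p.om * r))
      (Complex.exp (Complex.I * p.om * t) * (Complex.I * p.om)) t := by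
    have h1 : HasDerivAt (fun r : ℝ => Complex.I * p.om * (r : ℂ)) (Complex.I * p.om) t := by
      convert! (Complex.ofRealCLM.hasDerivAt (x := t)).const_mul (Complex.I * p.om) using 1
      simp
    exact h1.cexp
  have dc : HasDerivAt (fun r : ℝ => x - p.c * r) (-p.c) t := by
    simpa using ((hasDerivAt_id' t).const_mul p.c).const_sub x
  have e1 := (dt.mul ((d1 (x - p.c * t)).scomp t dc)).deriv
  have dx : ∀ y : ℝ, HasDerivAt (fun y : ℝ => y - p.c * t) 1 y := fun y =>
    (hasDerivAt_id' y).sub_const _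
  have e2 := funext fun y => (((d1 (y - p.c * t)).scomp y (dx y)).const_mul
    (Complex.exp (Complex.I * p.om * t))).deriv
  have e3 := (((d2 (x - p.c * t)).scomp x (dx x)).const_mul
    (Complex.exp (Complex.I * p.om * t))).deriv
  simp only [Function.comp_def, Pi.mul_def, Pi.add_def, one_smul] at e1 e2 e3
  rw [e1, e2, e3]
  simp only [σ, Complex.real_smul]
  push_cast
  -- The phase `e^{icx/2}` is chosen so that the terms in `q` cancel; what remains is `(ω - c²/4) I²
  -- φ + σ φ`, which vanishes since `I² = -1`.
  linear_combination Complex.exp (Complex.I * p.om * t) *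
    Complex.exp (Complex.I * p.c * ((x : ℂ) - p.c * t) / 2) * (φ j (x - p.c * t) : ℂ) *
    ((p.om : ℂ) - p.c ^ 2 / 4) * Complex.I_sq

theorem longWave (h : p.IsProfile φ q ψ s) (hγ : p.γ ≠ 0) (x t : ℝ) :
    deriv (fun r => ψ (x - p.c * r)) t +
      deriv (fun y => p.γ * deriv (deriv fun z => ψ (z - p.c * t)) y +
        (p.τ * ψ (y - p.c * t) + p.β / 2 * ψ (y - p.c * t) ^ 2)) x =
    -deriv (fun y => ∑ j, p.α j / 2 * φ j (y - p.c * t) ^ 2) x := by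
  have hd1 : (deriv fun z => ψ (z - p.c * t)) = fun z => s (z - p.c * t) :=
    funext fun z => ((h.deriv_ψ _).comp_sub_const z _).deriv
  have hd2 : ∀ y, deriv (fun z => s (z - p.c * t)) y = _ := fun y =>
    ((h.deriv_s _).comp_sub_const y _).deriv
  have dc : HasDerivAt (fun r : ℝ => x - p.c * r) (-p.c) t := by
    simpa using ((hasDerivAt_id' t).const_mul p.c).const_sub x
  have hS : HasDerivAt (fun y => ∑ j, p.α j / 2 * φ j (y - p.c * t) ^ 2)
      (∑ j, p.α j * φ j (x - p.c * t) * q j (x - p.c * t)) x := by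
    refine HasDerivAt.fun_sum fun j _ => ?_
    convert! (((h.deriv_φ j _).comp_sub_const x (p.c * t)).pow 2).const_mul (p.α j / 2) using 1
    norm_num
    ring
  -- The profile equation for `ψ` is the long-wave equation integrated once, so it evaluates the
  -- bracket without a third derivative of `ψ`.
  have hE : (fun y => p.γ * deriv (deriv fun z => ψ (z - p.c * t)) y +
        (p.τ * ψ (y - p.c * t) + p.β / 2 * ψ (y - p.c * t) ^ 2)) =
      fun y => p.c * ψ (y - p.c * t) - ∑ j, p.α j / 2 * φ j (y - p.c * t) ^ 2 := by
    funext y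
    have : ∑ j, p.α j / 2 * φ j (y - p.c * t) ^ 2 =
        1 / 2 * ∑ j, p.α j * φ j (y - p.c * t) ^ 2 := by
      rw [Finset.mul_sum]
      exact Finset.sum_congr rfl fun j _ => by ring
    rw [hd1, hd2, mul_inv_cancel_left₀ hγ, this, cτ]
    ring
  have e1 : deriv (fun r => ψ (x - p.c * r)) t = s (x - p.c * t) * -p.c :=
    ((h.deriv_ψ _).comp t dc).deriv
  rw [hE, e1, hS.deriv,
    ((((h.deriv_ψ _).comp_sub_const x (p.c * t)).const_mul p.c).fun_sub hS).deriv]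
  ring

theorem isSolitaryWave (h : p.IsProfile φ q ψ s) (hγ : p.γ ≠ 0)
    (h0 : (∃ j, φ j ≠ 0) ∨ ψ ≠ 0) :
    p.IsSolitaryWave (fun j x => Complex.exp (Complex.I * p.c * x / 2) * (φ j x : ℂ)) ψ := by
  have hu : ∀ j x t, ‖Complex.exp (Complex.I * p.om * (t : ℝ)) *
      (Complex.exp (Complex.I * p.c * ((x - p.c * t : ℝ) : ℂ) / 2) * (φ j (x - p.c * t) : ℂ))‖ ^ 2
      = φ j (x - p.c * t) ^ 2 := fun j x t => by
    have : Complex.I * p.om * (t : ℂ) = ((p.om * t : ℝ) : ℂ) * Complex.I := by push_cast; ring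
    rw [norm_mul, norm_mul, norm_exp_phase, this, Complex.norm_exp_ofReal_mul_I, one_mul, one_mul,
      Complex.norm_real, Real.norm_eq_abs, sq_abs]
  refine ⟨fun j => ?_, ?_, fun j => ?_, ?_, ?_, ?_, ?_, ?_, ?_⟩
  · have hφ : MemLp (fun x => (φ j x : ℂ)) 2 volume := (h.memLp_φ j).ofReal
    have hq : MemLp (fun x => (q j x : ℂ)) 2 volume := (h.memLp_q j).ofReal
    refine memH1_of_hasDerivAt (fun x => hasDerivAt_phase_mul (h.deriv_φ j x).ofReal_comp) ?_
      (memLp_phase_mul _ hφ) (memLp_phase_mul _ ((hφ.const_mul _).add hq))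
    have h1 := (h.contDiff_φ j).continuous
    have h2 := (h.contDiff_q j).continuous
    fun_prop
  · exact memH1_of_hasDerivAt h.deriv_ψ h.contDiff_s.continuous h.memLp_ψ h.memLp_s
  · rw [tendsto_zero_iff_norm_tendsto_zero]
    simpa [norm_exp_phase] using
      (tendsto_cocompact_of_memLp_two (h.deriv_φ j) (h.memLp_φ j) (h.memLp_q j)).abs
  · exact tendsto_cocompact_of_memLp_two h.deriv_ψ h.memLp_ψ h.memLp_s
  · refine h0.imp_left fun ⟨j, hj⟩ => ⟨j, fun he => hj (funext fun x => ?_)⟩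
    simpa using congrFun he x
  · intro j
    have h1 : ContDiff ℝ 2 (φ j) := contDiff_infty.1 (h.contDiff_φ j) 2
    have h2 : ContDiff ℝ 2 (fun x : ℝ => (x : ℂ)) := Complex.ofRealCLM.contDiff
    fun_prop
  · have h1 : ContDiff ℝ 3 ψ := contDiff_infty.1 h.contDiff_ψ 3
    fun_prop
  · exact h.schroedinger
  · intro x t
    simp only [hu]
    exact h.longWave hγ x t

end IsProfile

theorem IsQuotientMin.exists_solitaryWave (hσ : 0 ≤ p.σ) (hc : 0 ≤ p.cτ) (hγ : 0 < p.γ)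
    {Δ : Tuple N} (hΔ : p.IsQuotientMin Δ) :
    ∃ Φ : Tuple N, AEEqual (p.profile Δ) Φ ∧ p.SolvesODE Φ ∧
      p.IsSolitaryWave (fun j x => Complex.exp (Complex.I * p.c * x / 2) * (Φ.1 j x : ℂ)) Φ.2 := by
  obtain ⟨φ, q, ψ, s, h, he⟩ := hΔ.exists_isProfile hσ hc hγ
  -- It is the long-wave component that is nonzero: every term of `F` contains it, and `intF` of the
  -- profile is positive.
  refine ⟨(φ, ψ), he, h.solvesODE hγ.ne', h.isSolitaryWave hγ.ne' (Or.inr fun h0 => ?_)⟩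
  have hF : p.intF (p.profile Δ) = 0 := by
    refine integral_eq_zero_of_ae ?_
    filter_upwards [he.2] with x hx
    simp [F, hx, h0]
  rw [hΔ.intF_profile] at hF
  have := hΔ.Lam_pos hσ hc hγ
  exact absurd hF (by positivity)

end Params

end LSI

theorem proposition3p4 {N : ℕ} (p : LSI.Params N)
    (hc : 0 < p.c) (hσ : 0 < p.σ) (hτ : p.τ ≤ p.c) (hβ : 0 ≤ p.β) (hγ : 0 < p.γ)
    (hα : ∀ j, 0 < p.α j) :
    -- every solution of the constrained problem minimizes the quotient,
    -- and the wave profile built from it has the second form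
    (∀ lam : ℝ, 0 < lam → ∀ U : LSI.Tuple N, p.IsConstrainedMin lam U →
      p.IsQuotientMin U ∧ p.profile U = (2 / 3 * p.I 1 / LSI.cbrt lam) • U) ∧
    -- every minimizer of the quotient
    (∀ Δ : LSI.Tuple N, p.IsQuotientMin Δ →
      -- rescales to a solution of the constrained problem, for each `lam`, and the wave
      -- profile computed from that solution does not depend on `lam`
      (∀ lam : ℝ, 0 < lam → p.IsConstrainedMin lam (p.rescale lam Δ) ∧
        p.profile Δ = (2 / 3 * p.I 1 / LSI.cbrt lam) • p.rescale lam Δ) ∧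
      -- and its wave profile solves the differential equations and gives a solitary wave
      (∃ Φ : LSI.Tuple N, LSI.AEEqual (p.profile Δ) Φ ∧ p.SolvesODE Φ ∧
        p.IsSolitaryWave (fun j x => Complex.exp (Complex.I * p.c * x / 2) * (Φ.1 j x : ℂ))
          Φ.2)) :=
  ⟨fun _ hl _ hU => ⟨hU.isQuotientMin hl, hU.profile_eq hl⟩, fun _ hΔ =>
    ⟨fun _ hl => ⟨hΔ.isConstrainedMin_rescale hl, hΔ.profile_eq hl⟩,
      hΔ.exists_solitaryWave hσ.le (sub_nonneg.2 hτ) hγ⟩⟩
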